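/- Let $G=(V,E)$ be a finite simple undirected planar graph with a fixed combinatorial planar embedding (a cyclic order of the edges around each vertex for which Euler's formula holds in every connected component). Let $S=(s_1,\dots,s_\ell)$ be vertices that occur in this order, clockwise or counter-clockwise, along one traversal of the boundary walk of a face of $G$; in particular $S$ may be any sequence of consecutive vertices on a face. Let $d$ be either the unweighted distance in $G$ (the least number of edges of a walk between two vertices) or the weighted distance for an arbitrary assignment of non-negative real weights to the edges (the least total weight of a walk between two vertices), with $d=\infty$ between different connected components. Let $M\subseteq\mathbb R$ be an arbitrary set of real thresholds (for example $M=\{-1,0\}$). For $1\le i\le \ell-1$ and $\Delta\in M$ put $$A_i^\Delta:=\{v\in V : d(v,s_i)\le d(v,s_{i+1})+\Delta\},$$ and on the universe $X:=\{1,\dots,\ell\}\times M$ consider the family $$\mathcal F(S):=\bigl\{\{(i,\Delta) : 1\le i\le \ell-1,\ \Delta\in M,\ v\in A_i^\Delta\} : v\in V\bigr\}\subseteq 2^X .$$ Then the VC dimension of $\mathcal F(S)$ is at most $3$: if $Y\subseteq X$ is such that for every $Y'\subseteq Y$ there is $F\in\mathcal F(S)$ with $Y\cap F=Y'$, then $|Y|\le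 3$. -/

import Mathlib

open scoped ENNReal NNReal

noncomputable section

/-! ### VC dimension of a set system -/

/-- The family `F` shatters `Y`: every subset of `Y` is a trace `Y ∩ A` of a member `A` of `F`. -/
def ShattersSet {α : Type*} (F : Set (Set α)) (Y : Set α) : Prop :=
  ∀ Y' : Set α, Y' ⊆ Y → ∃ A ∈ F, Y ∩ A = Y'

/-- The VC dimension of the family `F` on the universe `X`: the largest size of a subset of `X`
that is shattered by `F` (a supremum in `ℕ∞`). -/
def setVCDim {α : Type*} (X : Set α) (F : Set (Set α)) : ℕ∞ :=
  ⨆ Y ∈ {Y : Set α | Y ⊆ X ∧ ShattersSet F Y}, Y.encard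

/-! ### Combinatorial planar embeddings -/

/-- A rotation system of a graph: for every vertex `v`, a cyclic ordering of the darts (directed
edges) that leave `v`. The permutation `rot` sends a dart to the next dart around its tail. -/
structure RotationSystem {V : Type*} (G : SimpleGraph V) where
  rot : Equiv.Perm G.Dart
  fst_rot : ∀ a : G.Dart, (rot a).fst = a.fst
  sameCycle_rot : ∀ a b : G.Dart, a.fst = b.fst → rot.SameCycle a b

namespace RotationSystem

variable {V : Type*} {G : SimpleGraph V}

/-- The face-tracing permutation: after the dart `a` from `u` to `v`, the walk along the face
continues with the dart that follows `(v, u)` in the rotation at `v`. Its orbits are the facial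
walks. -/
def facePerm (R : RotationSystem G) : Equiv.Perm G.Dart :=
  (SimpleGraph.Dart.symm_involutive (G := G)).toPerm.trans R.rot

/-- The facial walks of the rotation system, as the orbits of `facePerm`. -/
def FacialWalk (R : RotationSystem G) : Type _ :=
  Quotient (Equiv.Perm.SameCycle.setoid R.facePerm)

/-- The rotation system is planar (all components have genus `0`): Euler's formula
`|V| + |F| = |E| + 2 |C|`, where `C` is the set of connected components and `F` the set of facial
walks, each isolated vertex contributing one (trivial) facial walk. This is Euler's formula
`|V| - |E| + |F| = 2` summed over the components; no component has Euler characteristic above `2`,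
so the sum is attained only if the formula holds in each component. -/
def IsPlanar (R : RotationSystem G) : Prop :=
  Nat.card V + (Nat.card R.FacialWalk + Nat.card {v : V // ∀ u : V, ¬ G.Adj v u}) =
    Nat.card G.edgeSet + 2 * Nat.card G.ConnectedComponent

/-- The vertices `s 0, …, s (ℓ - 1)` appear in this order along one traversal of a facial walk:
for some starting dart `a`, `s j` is the vertex reached after `k j` steps of face tracing,
where `k` is increasing and the traversal does not go around the face more than once. (The vertices
are consecutive on the face when `k (j + 1) = k j + 1`.) A single vertex always lies on a face; this
is stated separately because the face around an isolated vertex has no darts. -/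
def InFacialOrder (R : RotationSystem G) {ℓ : ℕ} (s : Fin ℓ → V) : Prop :=
  ℓ ≤ 1 ∨ ∃ (a : G.Dart) (k : Fin ℓ → ℕ), StrictMono k ∧
    (∀ j, k j < Function.minimalPeriod R.facePerm a) ∧
    ∀ j, s j = ((R.facePerm)^[k j] a).fst

end RotationSystem

/-! ### Distances -/

/-- The number-of-edges distance, as an extended real (`⊤` between different components). -/
def hopDist {V : Type*} (G : SimpleGraph V) (u v : V) : EReal :=
  ((G.edist u v : ℝ≥0∞) : EReal)

/-- The weighted distance: the infimum over all walks from `u` to `v` of the total weight of the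
walk (`⊤` between different components). -/
def weightedDist {V : Type*} (G : SimpleGraph V) (w : Sym2 V → ℝ≥0) (u v : V) : EReal :=
  ((⨅ p : G.Walk u v, (((p.edges.map w).sum : ℝ≥0) : ℝ≥0∞) : ℝ≥0∞) : EReal)

/-! ### The set system of distance comparisons -/

/-- For a distance function `d`, the set `A_i^Δ` of all `v` with `d(v, s_i) ≤ d(v, s_{i+1}) + Δ`,
for an index `i` that is not the last one. -/
def nearSet {V : Type*} (d : V → V → EReal) {ℓ : ℕ} (s : Fin ℓ → V) (i : Fin ℓ)
    (hi : (i : ℕ) + 1 < ℓ) (Δ : ℝ) : Set V :=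
  {v | d v (s i) ≤ d v (s ⟨i + 1, hi⟩) + (Δ : EReal)}

/-- The universe: all pairs of an index and a threshold in `M`. -/
def thresholdUniverse (ℓ : ℕ) (M : Set ℝ) : Set (Fin ℓ × ℝ) :=
  {x | x.2 ∈ M}

/-- The member of the family that belongs to `v`: the pairs `(i, Δ)`, with `i` not the last index
and `Δ ∈ M`, such that `v ∈ A_i^Δ`. -/
def comparisonSet {V : Type*} (d : V → V → EReal) {ℓ : ℕ} (s : Fin ℓ → V) (M : Set ℝ) (v : V) :
    Set (Fin ℓ × ℝ) :=
  {x | x.2 ∈ M ∧ ∃ hi : (x.1 : ℕ) + 1 < ℓ, v ∈ nearSet d s x.1 hi x.2}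

/-- The family of all sets `{(i, Δ) : v ∈ A_i^Δ}`, one for each vertex `v`. -/
def comparisonFamily {V : Type*} (d : V → V → EReal) {ℓ : ℕ} (s : Fin ℓ → V) (M : Set ℝ) :
    Set (Set (Fin ℓ × ℝ)) :=
  Set.range (comparisonSet d s M)

end

/-!
Why the VC dimension is at most three.

Fix a distance threshold comparison `(i, Δ)`. If it holds at `u` and fails at `v`, then no shortest
path from `u` to `s i` meets a shortest path from `v` to `s (i + 1)`: exchanging their tails at a
common point would contradict the two comparisons (`disjoint_of_mem_nearSet`). Comparisons with the
same index are nested, so four shattered pairs have four different indices, and shattering yields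
vertices `u` and `v` such that `u` satisfies exactly the first and third comparison, `v` exactly
the second and fourth (`setVCDim_comparisonFamily_le_three`). This gives eight targets in cyclic
order on a face, belonging alternately to `u`, `v`, `v`, `u`, `u`, `v`, `v`, `u`, with disjoint
shortest paths for the two members of each of the four comparisons. Such a configuration does not
exist (`IsGeodesicDist.false_of_disjoint`), and the only topological input to this is that two walks
joining alternating vertices of a face have a common vertex
(`RotationSystem.IsPlanar.exists_mem_support`).

This last fact is a discrete Jordan curve theorem, which is derived from Euler's formula by linear
algebra over `ZMod 2`. For any rotation system the boundaries of faces are orthogonal to the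
coboundaries of vertices, and the kernels of both maps have dimension at most the number of
components, where isolated vertices count as trivial faces. Euler's formula says exactly that the
two ranges then exhaust the edge space, so every cycle is a sum of boundaries of faces
(`RotationSystem.IsPlanar.exists_faceBoundary_eq`). A walk between two vertices of a face, closed up
by an arc of that face, bounds a chain of faces, and this chain tells apart the corners on the arc
from the other corners of the face.
-/

/-! ### Exactness from a dimension count -/

/-- If the range of `δ` is orthogonal to that of `d` and the two dimensions add up to at least the
dimension of the whole space, then the range of `δ` is the full orthogonal complement. -/
theorem LinearMap.exists_eq_of_dotProduct_eq_zero {K E ι κ : Type*} [Field K] [Fintype E]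
    [Fintype ι] [Fintype κ] (d : (ι → K) →ₗ[K] (E → K)) (δ : (κ → K) →ₗ[K] (E → K))
    (orth : ∀ g φ, δ φ ⬝ᵥ d g = 0)
    (hdim : Fintype.card E ≤ Module.finrank K (LinearMap.range d) +
      Module.finrank K (LinearMap.range δ))
    (z : E → K) (hz : ∀ g, z ⬝ᵥ d g = 0) : ∃ φ, δ φ = z := by
  classical
  set M := LinearMap.toMatrix' d with hM
  have hd : ∀ g, d g = M.mulVec g := fun g => by
    rw [hM, LinearMap.toMatrix'_mulVec]
  have key : ∀ y : E → K, (∀ g, y ⬝ᵥ d g = 0) → y ∈ LinearMap.ker M.transpose.mulVecLin := by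
    intro y hy
    rw [LinearMap.mem_ker, Matrix.mulVecLin_apply, Matrix.mulVec_transpose]
    refine dotProduct_eq_zero _ fun g => ?_
    rw [← Matrix.dotProduct_mulVec, ← hd, hy]
  have hle : LinearMap.range δ ≤ LinearMap.ker M.transpose.mulVecLin := by
    rintro _ ⟨φ, rfl⟩
    exact key _ fun g => orth g φ
  have hrank : Module.finrank K (LinearMap.range M.transpose.mulVecLin) =
      Module.finrank K (LinearMap.range d) := by
    have h1 : M.transpose.rank = M.rank := Matrix.rank_transpose M
    have h2 : M.mulVecLin = d := by
      ext1 g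
      ext1
      simp [hd]
    rw [Matrix.rank, Matrix.rank, h2] at h1
    exact h1
  have hsum := LinearMap.finrank_range_add_finrank_ker M.transpose.mulVecLin
  rw [Module.finrank_fintype_fun_eq_card] at hsum
  have heq := Submodule.eq_of_le_of_finrank_le hle (by omega)
  have := key z hz
  rwa [← heq] at this

theorem LinearMap.card_le_finrank_range_add {K ι κ M : Type*} [Field K] [Fintype ι] [Fintype κ]
    [AddCommGroup M] [Module K M] (f : (ι → K) →ₗ[K] M) (T : (κ → K) →ₗ[K] (ι → K))
    (h : LinearMap.ker f ≤ LinearMap.range T) :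
    Fintype.card ι ≤ Module.finrank K (LinearMap.range f) + Fintype.card κ := by
  have h1 := LinearMap.finrank_range_add_finrank_ker f
  have h2 := Submodule.finrank_mono h
  have h3 := LinearMap.finrank_range_le T
  rw [Module.finrank_fintype_fun_eq_card] at h1 h3
  omega

namespace RotationSystem

variable {V : Type*} {G : SimpleGraph V}

/-! ### Faces and their boundaries -/

/-- The facial walk that contains a given dart. -/
def face (R : RotationSystem G) (a : G.Dart) : R.FacialWalk :=
  Quotient.mk (Equiv.Perm.SameCycle.setoid R.facePerm) a

theorem face_eq_iff (R : RotationSystem G) {a b : G.Dart} :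
    R.face a = R.face b ↔ R.facePerm.SameCycle a b :=
  Quotient.eq (r := Equiv.Perm.SameCycle.setoid R.facePerm)

theorem facePerm_apply (R : RotationSystem G) (a : G.Dart) : R.facePerm a = R.rot a.symm := rfl

@[simp]
theorem face_facePerm (R : RotationSystem G) (a : G.Dart) : R.face (R.facePerm a) = R.face a := by
  rw [face_eq_iff, Equiv.Perm.sameCycle_apply_left]

@[simp]
theorem fst_facePerm (R : RotationSystem G) (a : G.Dart) : (R.facePerm a).fst = a.snd := by
  rw [facePerm_apply, fst_rot]
  rfl

/-- A dart on a given facial walk. -/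
noncomputable def faceDart (R : RotationSystem G) (f : R.FacialWalk) : G.Dart :=
  Quotient.out (s := Equiv.Perm.SameCycle.setoid R.facePerm) f

theorem face_faceDart (R : RotationSystem G) (f : R.FacialWalk) : R.face (R.faceDart f) = f :=
  Quotient.out_eq (s := Equiv.Perm.SameCycle.setoid R.facePerm) f

/-- A function on darts that is invariant under the rotation at `x` is constant on the darts
leaving `x`. -/
theorem eq_of_rot_invariant (R : RotationSystem G) {β : Type*} (ψ : G.Dart → β) {x : V}
    (h : ∀ a : G.Dart, a.fst = x → ψ (R.rot a) = ψ a) {a b : G.Dart} (ha : a.fst = x)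
    (hb : b.fst = x) : ψ a = ψ b := by
  have hx : ∀ n : ℤ, ((R.rot ^ n) a).fst = x ∧ ψ ((R.rot ^ n) a) = ψ a := by
    intro n
    induction n using Int.induction_on with
    | zero => simp [ha]
    | succ n ih =>
      rw [add_comm, zpow_add, zpow_one, Equiv.Perm.mul_apply, fst_rot, h _ ih.1]
      exact ih
    | pred n ih =>
      have e : (R.rot ^ (-(n : ℤ))) a = R.rot ((R.rot ^ (-(n : ℤ) - 1)) a) := by
        rw [← Equiv.Perm.mul_apply, ← zpow_one_add]
        congr 2
        ring
      rw [e, fst_rot] at ih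
      exact ⟨ih.1, (h _ ih.1).symm.trans ih.2⟩
  obtain ⟨n, rfl⟩ := R.sameCycle_rot a b (ha.trans hb.symm)
  exact (hx n).2.symm

/-- A dart orienting a given edge. -/
noncomputable def edgeDart (e : G.edgeSet) : G.Dart :=
  (show ∃ a : G.Dart, a.edge = e by
    obtain ⟨⟨x, y⟩, h⟩ := e
    exact ⟨⟨(x, y), h⟩, rfl⟩).choose

theorem edge_edgeDart (e : G.edgeSet) : (edgeDart e).edge = e :=
  (show ∃ a : G.Dart, a.edge = e by
    obtain ⟨⟨x, y⟩, h⟩ := e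
    exact ⟨⟨(x, y), h⟩, rfl⟩).choose_spec

/-- The edge underlying a dart, as an element of the edge set. -/
def dartEdge (a : G.Dart) : G.edgeSet := ⟨a.edge, a.edge_mem⟩

theorem edgeDart_dartEdge (a : G.Dart) : edgeDart (dartEdge a) = a ∨
    edgeDart (dartEdge a) = a.symm :=
  (SimpleGraph.dart_edge_eq_iff _ _).1 (edge_edgeDart (dartEdge a))

theorem sum_edgeDart_add_symm [Fintype G.Dart] [Fintype G.edgeSet] {M : Type*} [AddCommMonoid M]
    (h : G.Dart → M) : ∑ e : G.edgeSet, (h (edgeDart e) + h (edgeDart e).symm) = ∑ a, h a := by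
  classical
  rw [← Finset.sum_fiberwise Finset.univ dartEdge h]
  refine Finset.sum_congr rfl fun e _ => ?_
  have : Finset.univ.filter (fun a : G.Dart => dartEdge a = e) =
      {edgeDart e, (edgeDart e).symm} := by
    ext a
    simp only [Finset.mem_filter, Finset.mem_univ, true_and, Finset.mem_insert,
      Finset.mem_singleton]
    rw [← SimpleGraph.dart_edge_eq_iff, edge_edgeDart, dartEdge, Subtype.ext_iff]
  rw [this, Finset.sum_pair (SimpleGraph.Dart.symm_ne _).symm]

/-- The coboundary of a function on vertices, modulo `2`: its value at an edge is the sum of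
the values at the two ends. -/
noncomputable def vertexCoboundary (G : SimpleGraph V) :
    (V → ZMod 2) →ₗ[ZMod 2] (G.edgeSet → ZMod 2) where
  toFun g e := g (edgeDart e).fst + g (edgeDart e).snd
  map_add' g h := by ext e; simp only [Pi.add_apply]; ring
  map_smul' c g := by ext e; simp only [Pi.smul_apply, smul_eq_mul, RingHom.id_apply]; ring

theorem vertexCoboundary_dartEdge (g : V → ZMod 2) (a : G.Dart) :
    vertexCoboundary G g (dartEdge a) = g a.fst + g a.snd := by
  change g _ + g _ = _
  rcases edgeDart_dartEdge a with h | h <;> rw [h]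
  exact add_comm _ _

/-- The boundary, modulo `2`, of a chain of facial walks: its value at an edge is the sum of the
coefficients on the two sides. The trivial facial walks around isolated vertices, which
Euler's formula counts, have boundary zero. -/
noncomputable def faceBoundary (R : RotationSystem G) :
    (R.FacialWalk ⊕ {v : V // ∀ u : V, ¬ G.Adj v u} → ZMod 2) →ₗ[ZMod 2]
      (G.edgeSet → ZMod 2) where
  toFun φ e := φ (.inl (R.face (edgeDart e))) + φ (.inl (R.face (edgeDart e).symm))
  map_add' g h := by ext e; simp only [Pi.add_apply]; ring
  map_smul' c g := by ext e; simp only [Pi.smul_apply, smul_eq_mul, RingHom.id_apply]; ring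

theorem faceBoundary_dartEdge (R : RotationSystem G)
    (φ : R.FacialWalk ⊕ {v : V // ∀ u : V, ¬ G.Adj v u} → ZMod 2) (a : G.Dart) :
    R.faceBoundary φ (dartEdge a) = φ (.inl (R.face a)) + φ (.inl (R.face a.symm)) := by
  change φ _ + φ _ = _
  rcases edgeDart_dartEdge a with h | h <;> rw [h]
  rw [SimpleGraph.Dart.symm_symm]
  exact add_comm _ _

/-- The boundary of a facial walk is a cycle: it is orthogonal to every coboundary. -/
theorem faceBoundary_dotProduct_vertexCoboundary [Fintype G.Dart] [Fintype G.edgeSet]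
    (R : RotationSystem G) (φ : R.FacialWalk ⊕ {v : V // ∀ u : V, ¬ G.Adj v u} → ZMod 2)
    (g : V → ZMod 2) : R.faceBoundary φ ⬝ᵥ vertexCoboundary G g = 0 := by
  have h1 : R.faceBoundary φ ⬝ᵥ vertexCoboundary G g =
      ∑ a : G.Dart, φ (.inl (R.face a)) * (g a.fst + g a.snd) := by
    rw [← sum_edgeDart_add_symm, dotProduct]
    refine Finset.sum_congr rfl fun e _ => ?_
    change (φ _ + φ _) * (g _ + g _) = _ * (g _ + g _) + _ * (g _ + g _)
    simp only [SimpleGraph.Dart.symm_toProd, Prod.fst_swap, Prod.snd_swap]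
    ring
  -- Re-indexing by the face-tracing permutation turns heads into tails.
  have h2 : ∑ a : G.Dart, φ (.inl (R.face a)) * g a.snd =
      ∑ a : G.Dart, φ (.inl (R.face a)) * g a.fst := by
    rw [← Equiv.sum_comp R.facePerm fun a : G.Dart => φ (.inl (R.face a)) * g a.fst]
    simp
  rw [h1]
  simp only [mul_add, Finset.sum_add_distrib]
  rw [h2]
  exact CharTwo.add_self_eq_zero _

/-- A function on vertices without coboundary is constant on connected components. -/
theorem ker_vertexCoboundary_le (G : SimpleGraph V) :
    LinearMap.ker (vertexCoboundary G) ≤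
      LinearMap.range (LinearMap.funLeft (ZMod 2) (ZMod 2) G.connectedComponentMk) := by
  intro g hg
  have hadj : ∀ x y, G.Adj x y → g x = g y := fun x y h => by
    have := congrFun hg (dartEdge ⟨(x, y), h⟩)
    rw [vertexCoboundary_dartEdge] at this
    exact CharTwo.add_eq_zero.1 this
  refine ⟨fun c => c.lift g fun x y p _ => ?_, ?_⟩
  · clear * - p hadj
    induction p with
    | nil => rfl
    | cons h p ih => exact (hadj _ _ h).trans ih
  · ext x
    rfl

theorem exists_dart_of_reachable {x y : V} (h : G.Reachable x y) (b : G.Dart) (hb : b.fst = y) :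
    ∃ a : G.Dart, a.fst = x := by
  obtain ⟨p⟩ := h
  cases p with
  | nil => exact ⟨b, hb⟩
  | cons h p => exact ⟨⟨(x, _), h⟩, rfl⟩

/-- A chain of facial walks without boundary has the same coefficient on all faces of a
connected component: neighbouring darts, around a vertex or along an edge, have the same
coefficient. -/
theorem ker_faceBoundary_le (R : RotationSystem G) :
    LinearMap.ker R.faceBoundary ≤ LinearMap.range (LinearMap.funLeft (ZMod 2) (ZMod 2)
      (Sum.elim (fun f : R.FacialWalk => G.connectedComponentMk (R.faceDart f).fst)
        (fun v : {v : V // ∀ u : V, ¬ G.Adj v u} => G.connectedComponentMk v.1))) := by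
  classical
  intro φ hφ
  set ψ : G.Dart → ZMod 2 := fun a => φ (.inl (R.face a)) with hψ
  have hsymm : ∀ a, ψ a.symm = ψ a := fun a => by
    have := congrFun hφ (dartEdge a)
    rw [faceBoundary_dartEdge] at this
    exact (CharTwo.add_eq_zero.1 this).symm
  have hrot : ∀ a, ψ (R.rot a) = ψ a := fun a => by
    rw [← hsymm a, hψ]
    change φ _ = φ _
    rw [← R.face_facePerm a.symm, facePerm_apply, SimpleGraph.Dart.symm_symm]
  have hconst : ∀ {x y : V}, G.Walk x y → ∀ a b : G.Dart, a.fst = x → b.fst = y → ψ a = ψ b := by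
    intro x y p
    induction p with
    | nil => exact fun a b ha hb => R.eq_of_rot_invariant ψ (fun a _ => hrot a) ha hb
    | @cons x y z h p ih =>
      intro a b ha hb
      let c : G.Dart := ⟨(x, y), h⟩
      rw [R.eq_of_rot_invariant ψ (fun a _ => hrot a) ha (b := c) rfl, ← hsymm]
      exact ih _ _ rfl hb
  choose r hr using fun c : G.ConnectedComponent => c.exists_rep
  have hr' : ∀ x, G.Reachable (r (G.connectedComponentMk x)) x := fun x =>
    SimpleGraph.ConnectedComponent.exact (hr _)
  let H : G.ConnectedComponent → ZMod 2 := fun c =>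
    if h : ∃ a : G.Dart, a.fst = r c then ψ h.choose
    else φ (.inr ⟨r c, fun u hu => h ⟨⟨(_, u), hu⟩, rfl⟩⟩)
  refine ⟨H, funext fun x => ?_⟩
  change H _ = _
  rcases x with f | ⟨v, hv⟩
  · change H (G.connectedComponentMk (R.faceDart f).fst) = _
    have hex := exists_dart_of_reachable (hr' (R.faceDart f).fst) _ rfl
    simp only [H]
    rw [dif_pos hex, hconst (hr' _).some _ _ hex.choose_spec rfl, hψ]
    simp only [face_faceDart]
  · change H (G.connectedComponentMk v) = _
    have hv' : r (G.connectedComponentMk v) = v := by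
      obtain ⟨p⟩ := (hr' v).symm
      generalize r (G.connectedComponentMk v) = w at p
      cases p with
      | nil => rfl
      | cons h p => exact (hv _ h).elim
    simp only [H]
    rw [dif_neg]
    · congr 2
      exact Subtype.ext hv'
    · rintro ⟨a, ha⟩
      exact hv a.snd (hv' ▸ ha ▸ a.adj)

/-- In a planar rotation system every cycle modulo `2` is a sum of boundaries of faces. The
two kernels above are small, so Euler's formula leaves no room between the two spaces. -/
theorem IsPlanar.exists_faceBoundary_eq [Finite V] [Fintype G.edgeSet] {R : RotationSystem G}
    (hR : R.IsPlanar) (z : G.edgeSet → ZMod 2) (hz : ∀ g, z ⬝ᵥ vertexCoboundary G g = 0) :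
    ∃ φ, R.faceBoundary φ = z := by
  classical
  have := Fintype.ofFinite V
  have : Finite R.FacialWalk := inferInstanceAs (Finite (Quotient _))
  have := Fintype.ofFinite R.FacialWalk
  have := Fintype.ofFinite G.ConnectedComponent
  have h1 := LinearMap.card_le_finrank_range_add _ _ (ker_vertexCoboundary_le G)
  have h2 := LinearMap.card_le_finrank_range_add _ _ R.ker_faceBoundary_le
  refine LinearMap.exists_eq_of_dotProduct_eq_zero (vertexCoboundary G) R.faceBoundary
    (fun g φ => R.faceBoundary_dotProduct_vertexCoboundary φ g) ?_ z hz
  unfold IsPlanar at hR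
  rw [Fintype.card_sum] at h2
  simp only [Nat.card_eq_fintype_card] at hR
  omega

/-! ### Walks between alternating vertices of a face -/

open Classical in
/-- The chain modulo `2` of the edges of a list of darts. -/
noncomputable def dartChain (l : List G.Dart) : G.edgeSet → ZMod 2 :=
  (l.map fun a => Pi.single (dartEdge a) 1).sum

theorem dartChain_cons (a : G.Dart) (l : List G.Dart) [DecidableEq G.edgeSet] :
    dartChain (a :: l) = Pi.single (dartEdge a) 1 + dartChain l := by
  rw [dartChain, List.map_cons, List.sum_cons]
  congr!

theorem dartChain_dotProduct [Fintype G.edgeSet] (l : List G.Dart) (h : G.edgeSet → ZMod 2) :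
    dartChain l ⬝ᵥ h = (l.map fun a => h (dartEdge a)).sum := by
  classical
  induction l with
  | nil => simp [dartChain]
  | cons a l ih => rw [dartChain_cons, add_dotProduct, ih]; simp

theorem dartChain_darts_dotProduct_vertexCoboundary [Fintype G.edgeSet] {x y : V}
    (p : G.Walk x y) (g : V → ZMod 2) :
    dartChain p.darts ⬝ᵥ vertexCoboundary G g = g x + g y := by
  rw [dartChain_dotProduct]
  simp only [vertexCoboundary_dartEdge]
  induction p with
  | nil => exact (CharTwo.add_self_eq_zero _).symm
  | @cons x y z h p ih =>
    rw [SimpleGraph.Walk.darts_cons, List.map_cons, List.sum_cons, ih]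
    linear_combination CharTwo.add_self_eq_zero (g y)

theorem dartChain_darts_eq_zero {x y : V} (p : G.Walk x y) (b : G.Dart)
    (hb : b.fst ∉ p.support) : dartChain p.darts (dartEdge b) = 0 := by
  classical
  have : ∀ l : List G.Dart, (∀ d ∈ l, d ∈ p.darts) → dartChain l (dartEdge b) = 0 := by
    intro l
    induction l with
    | nil => intro _; simp [dartChain]
    | cons d l ih =>
      intro hl
      have hd := hl d List.mem_cons_self
      rw [dartChain_cons, Pi.add_apply, ih fun e he => hl e (List.mem_cons_of_mem _ he),
        Pi.single_eq_of_ne, add_zero]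
      intro h
      rcases (SimpleGraph.dart_edge_eq_iff _ _).1 (congrArg Subtype.val h) with rfl | rfl
      · exact hb (p.dart_fst_mem_support_of_mem_darts hd)
      · exact hb (p.dart_snd_mem_support_of_mem_darts hd)
  exact this _ fun _ h => h

open Classical in
/-- The number, modulo `2`, of times that a dart is traversed in the steps `i, …, k - 1` of
face tracing from `a`. -/
noncomputable def arcCount (R : RotationSystem G) (a : G.Dart) (i k : ℕ) (b : G.Dart) : ZMod 2 :=
  ∑ t ∈ Finset.Ico i k, if R.facePerm^[t] a = b then 1 else 0

/-- The arc count changes along the face only at the two ends of the arc. -/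
theorem arcCount_facePerm (R : RotationSystem G) {a : G.Dart} {i k : ℕ} (hik : i ≤ k)
    {b : G.Dart} (hi : R.facePerm^[i] a ≠ R.facePerm b) (hk : R.facePerm^[k] a ≠ R.facePerm b) :
    R.arcCount a i k (R.facePerm b) = R.arcCount a i k b := by
  classical
  have h1 := Finset.sum_Ico_succ_top hik
    fun t => if R.facePerm^[t] a = R.facePerm b then (1 : ZMod 2) else 0
  rw [Finset.sum_eq_sum_Ico_succ_bot (by omega), if_neg hi, if_neg hk, add_zero, zero_add,
    ← Finset.sum_Ico_add'] at h1
  simp only [arcCount]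
  rw [← h1]
  refine Finset.sum_congr rfl fun t _ => ?_
  simp only [Function.iterate_succ_apply', EmbeddingLike.apply_eq_iff_eq]

theorem arcCount_iterate (R : RotationSystem G) {a : G.Dart} {i k j : ℕ}
    (hk : k ≤ Function.minimalPeriod R.facePerm a) (hj : j < Function.minimalPeriod R.facePerm a) :
    R.arcCount a i k (R.facePerm^[j] a) = if i ≤ j ∧ j < k then 1 else 0 := by
  classical
  have : ∀ t ∈ Finset.Ico i k, (if R.facePerm^[t] a = R.facePerm^[j] a then (1 : ZMod 2) else 0) =
      if t = j then 1 else 0 := fun t ht => by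
    congr 1
    rw [Function.iterate_eq_iterate_iff_of_lt_minimalPeriod
      ((Finset.mem_Ico.1 ht).2.trans_le hk) hj]
  rw [arcCount, Finset.sum_congr rfl this, Finset.sum_ite_eq']
  simp

/-- The chain modulo `2` of the edges traversed in the steps `i, …, k - 1` of face tracing
from `a`. -/
noncomputable def arcChain (R : RotationSystem G) (a : G.Dart) (i k : ℕ) : G.edgeSet → ZMod 2 :=
  ∑ t ∈ Finset.Ico i k, dartChain [R.facePerm^[t] a]

theorem arcChain_dotProduct_vertexCoboundary [Fintype G.edgeSet] (R : RotationSystem G)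
    (a : G.Dart) {i k : ℕ} (hik : i ≤ k) (g : V → ZMod 2) :
    R.arcChain a i k ⬝ᵥ vertexCoboundary G g =
      g (R.facePerm^[i] a).fst + g (R.facePerm^[k] a).fst := by
  induction k, hik using Nat.le_induction with
  | base => simpa [arcChain] using (CharTwo.add_self_eq_zero _).symm
  | succ k hik ih =>
    rw [arcChain, Finset.sum_Ico_succ_top hik, ← arcChain, add_dotProduct, ih,
      dartChain_dotProduct, List.map_singleton, List.sum_singleton, vertexCoboundary_dartEdge,
      Function.iterate_succ_apply', fst_facePerm]
    linear_combination CharTwo.add_self_eq_zero (g (R.facePerm^[k] a).fst)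

theorem arcChain_dartEdge (R : RotationSystem G) (a : G.Dart) (i k : ℕ) (b : G.Dart) :
    R.arcChain a i k (dartEdge b) = R.arcCount a i k b + R.arcCount a i k b.symm := by
  classical
  rw [arcChain, Finset.sum_apply, arcCount, arcCount, ← Finset.sum_add_distrib]
  refine Finset.sum_congr rfl fun t _ => ?_
  have h : dartEdge b = dartEdge (R.facePerm^[t] a) ↔
      R.facePerm^[t] a = b ∨ R.facePerm^[t] a = b.symm := by
    rw [← SimpleGraph.dart_edge_eq_iff, dartEdge, dartEdge, Subtype.mk.injEq, eq_comm]
  rw [dartChain_cons, Pi.add_apply, Pi.single_apply]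
  by_cases h1 : R.facePerm^[t] a = b
  · rw [if_pos (h.2 (.inl h1)), if_pos h1, if_neg]
    · simp [dartChain]
    · rw [h1]; exact b.symm_ne.symm
  · by_cases h2 : R.facePerm^[t] a = b.symm
    · rw [if_pos (h.2 (.inr h2)), if_neg h1, if_pos h2]
      simp [dartChain]
    · rw [if_neg (by tauto), if_neg h1, if_neg h2]
      simp [dartChain]

/-- Two walks that join alternating vertices of a facial walk have a common vertex. The first
walk `p`, closed up by an arc of the face, is the boundary of a chain of faces. The coefficients
of this chain, corrected by one along the arc, change only across edges of `p` and at corners at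
the ends of `p`. They are therefore constant along a walk that avoids `p`; but one end of `q` is
on the arc and the other is not. -/
theorem IsPlanar.exists_mem_support [Finite V] {R : RotationSystem G} (hR : R.IsPlanar)
    {a : G.Dart} {i j k l : ℕ} (hij : i < j) (hjk : j < k) (hkl : k < l)
    (hl : l < Function.minimalPeriod R.facePerm a)
    (p : G.Walk (R.facePerm^[i] a).fst (R.facePerm^[k] a).fst)
    (q : G.Walk (R.facePerm^[j] a).fst (R.facePerm^[l] a).fst) :
    ∃ x ∈ p.support, x ∈ q.support := by
  classical
  by_contra! hpq
  have := Fintype.ofFinite V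
  have hik : i ≤ k := (hij.trans hjk).le
  obtain ⟨φ, hφ⟩ := hR.exists_faceBoundary_eq (dartChain p.darts + R.arcChain a i k) fun g => by
    rw [add_dotProduct, dartChain_darts_dotProduct_vertexCoboundary,
      R.arcChain_dotProduct_vertexCoboundary a hik]
    exact CharTwo.add_self_eq_zero _
  set ψ : G.Dart → ZMod 2 := fun b => φ (.inl (R.face b)) + R.arcCount a i k b with hψ
  have hsymm : ∀ b : G.Dart, b.fst ∉ p.support → ψ b.symm = ψ b := fun b hb => by
    have h := congrFun hφ (dartEdge b)
    rw [faceBoundary_dartEdge, Pi.add_apply, dartChain_darts_eq_zero p b hb, zero_add,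
      arcChain_dartEdge] at h
    simp only [hψ]
    linear_combination h + CharTwo.add_self_eq_zero (R.arcCount a i k b.symm) -
      CharTwo.add_self_eq_zero (φ (.inl (R.face b)))
  have hrot : ∀ b : G.Dart, b.fst ∉ p.support → ψ (R.rot b) = ψ b := fun b hb => by
    have hb' : R.rot b = R.facePerm b.symm := by
      rw [facePerm_apply, SimpleGraph.Dart.symm_symm]
    have hne : ∀ t, (R.facePerm^[t] a).fst ∈ p.support →
        R.facePerm^[t] a ≠ R.facePerm b.symm := fun t ht h => by
      rw [h, ← hb', fst_rot] at ht
      exact hb ht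
    rw [← hsymm b hb, hb', hψ]
    simp only [face_facePerm]
    rw [R.arcCount_facePerm hik (hne i p.start_mem_support) (hne k p.end_mem_support)]
  have hconst : ∀ {x y : V} (q : G.Walk x y), (∀ w ∈ q.support, w ∉ p.support) →
      ∀ b c : G.Dart, b.fst = x → c.fst = y → ψ b = ψ c := by
    intro x y q
    induction q with
    | nil =>
      intro hq b c hb hc
      exact R.eq_of_rot_invariant ψ (fun d hd => hrot d (hd ▸ hq _ (by simp))) hb hc
    | @cons x y z h q ih =>
      intro hq b c hb hc
      have hx : x ∉ p.support := hq _ (by simp)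
      let d : G.Dart := ⟨(x, y), h⟩
      rw [R.eq_of_rot_invariant ψ (fun e he => hrot e (he ▸ hx)) hb (b := d) rfl, ← hsymm d hx]
      exact ih (fun w hw => hq w (by simp [hw])) _ _ rfl hc
  have hface : ∀ t, R.face (R.facePerm^[t] a) = R.face a := fun t => by
    induction t with
    | zero => rfl
    | succ t ih => rw [Function.iterate_succ_apply', face_facePerm, ih]
  have h := hconst q (fun w hw hw' => hpq w hw' hw) _ _ rfl rfl
  simp only [hψ, hface] at h
  rw [R.arcCount_iterate (hkl.trans hl).le hl,
    R.arcCount_iterate (hkl.trans hl).le ((hjk.trans hkl).trans hl), if_pos ⟨hij.le, hjk⟩,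
    if_neg (by omega), add_right_inj] at h
  exact one_ne_zero h

end RotationSystem

/-! ### Geodesic intervals and walks that cross -/

section Geodesic

variable {V : Type*} {D : V → V → ℝ≥0∞} {G : SimpleGraph V}

/-- The points on shortest paths from `u` to `a`, for a distance function `D`. -/
def geodesicInterval (D : V → V → ℝ≥0∞) (u a : V) : Set V :=
  {z | D u z + D z a = D u a}

/-- `D` satisfies the triangle inequality, and points at finite distance are joined by a walk of
`G` inside the geodesic interval between them. -/
structure IsGeodesicDist (G : SimpleGraph V) (D : V → V → ℝ≥0∞) : Prop where
  triangle : ∀ x y z, D x z ≤ D x y + D y z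
  exists_walk : ∀ x y, D x y ≠ ⊤ → ∃ p : G.Walk x y, ∀ z ∈ p.support, z ∈ geodesicInterval D x y

/-- Every walk from `a` to `c` meets every walk from `b` to `d`. -/
def WalksMeet (G : SimpleGraph V) (a c b d : V) : Prop :=
  ∀ (p : G.Walk a c) (q : G.Walk b d), ∃ z ∈ p.support, z ∈ q.support

theorem WalksMeet.symm {a c b d : V} (h : WalksMeet G a c b d) : WalksMeet G b d a c :=
  fun p q => (h q p).imp fun _ hz => hz.symm

theorem WalksMeet.swap {a c b d : V} (h : WalksMeet G a c b d) : WalksMeet G c a b d :=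
  fun p q => by simpa using h p.reverse q

theorem WalksMeet.swap_right {a c b d : V} (h : WalksMeet G a c b d) : WalksMeet G a c d b :=
  h.symm.swap.symm

namespace IsGeodesicDist

variable {u v x z w a b c e : V}

theorem mem_of_le (hD : IsGeodesicDist G D) (h : D u z + D z a ≤ D u a) :
    z ∈ geodesicInterval D u a :=
  h.antisymm (hD.triangle _ _ _)

theorem swap_le (hD : IsGeodesicDist G D) (h1 : z ∈ geodesicInterval D v a)
    (h2 : z ∈ geodesicInterval D u b) : D v b + D u a ≤ D v a + D u b :=
  calc D v b + D u a ≤ (D v z + D z b) + (D u z + D z a) :=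
        add_le_add (hD.triangle _ _ _) (hD.triangle _ _ _)
    _ = (D v z + D z a) + (D u z + D z b) := by ring
    _ = D v a + D u b := by rw [h1, h2]

theorem ne_top_of_mem (h : z ∈ geodesicInterval D u a) (hu : D u a ≠ ⊤) : D z a ≠ ⊤ := by
  intro hz
  rw [← h, hz, add_top] at hu
  exact hu rfl

theorem mem_trans (hD : IsGeodesicDist G D) (hz : z ∈ geodesicInterval D u a)
    (hw : w ∈ geodesicInterval D z a) : w ∈ geodesicInterval D u a :=
  hD.mem_of_le <| calc
    D u w + D w a ≤ (D u z + D z w) + D w a := by gcongr; exact hD.triangle _ _ _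
    _ = D u z + (D z w + D w a) := add_assoc _ _ _
    _ = D u a := by rw [hw, hz]

/-- If shortest paths from `u` to `a` and to `b` meet again at `w` after the first one has passed
through `z`, then `z` is also on a shortest path from `u` to `b`. -/
theorem mem_of_tail (hD : IsGeodesicDist G D) (hua : D u a ≠ ⊤)
    (hz : z ∈ geodesicInterval D u a) (hw : w ∈ geodesicInterval D z a)
    (hb : w ∈ geodesicInterval D u b) : z ∈ geodesicInterval D u b := by
  have hwa : D w a ≠ ⊤ := ne_top_of_mem (hD.mem_trans hz hw) hua
  have h : D u z + D z w ≤ D u w := by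
    refine (ENNReal.add_le_add_iff_right hwa).1 ?_
    rw [add_assoc, hw, hz]
    exact hD.triangle _ _ _
  refine hD.mem_of_le ?_
  calc D u z + D z b ≤ D u z + (D z w + D w b) := by gcongr; exact hD.triangle _ _ _
    _ = (D u z + D z w) + D w b := (add_assoc _ _ _).symm
    _ ≤ D u w + D w b := by gcongr
    _ = D u b := hb

/-- The tails of two shortest paths that meet at `x` join the ends of these paths. -/
theorem exists_walk_of_mem (hD : IsGeodesicDist G D) (hua : D u a ≠ ⊤) (hvb : D v b ≠ ⊤)
    (hx : x ∈ geodesicInterval D u a) (hx' : x ∈ geodesicInterval D v b) :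
    ∃ p : G.Walk a b, ∀ z ∈ p.support,
      z ∈ geodesicInterval D x a ∨ z ∈ geodesicInterval D x b := by
  obtain ⟨p, hp⟩ := hD.exists_walk x a (ne_top_of_mem hx hua)
  obtain ⟨q, hq⟩ := hD.exists_walk x b (ne_top_of_mem hx' hvb)
  refine ⟨p.reverse.append q, fun z hz => ?_⟩
  rw [SimpleGraph.Walk.mem_support_append_iff, SimpleGraph.Walk.support_reverse,
    List.mem_reverse] at hz
  exact hz.imp (hp z) (hq z)

/-- Shortest paths from `u` to `a` and `b` cannot both cross over to the respective other path in
a pair of shortest paths from `v` to `a'` and `b'`, if the pairs `{a, b'}` and `{b, a'}` cross: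
the exchanged tails would meet. -/
theorem disjoint_or_disjoint (hD : IsGeodesicDist G D) {a' b' : V} (ha : D u a ≠ ⊤)
    (hb : D u b ≠ ⊤) (ha' : D v a' ≠ ⊤) (hb' : D v b' ≠ ⊤)
    (haa : Disjoint (geodesicInterval D u a) (geodesicInterval D v a'))
    (hbb : Disjoint (geodesicInterval D u b) (geodesicInterval D v b'))
    (hm : WalksMeet G a b' b a') :
    Disjoint (geodesicInterval D u a) (geodesicInterval D v b') ∨
      Disjoint (geodesicInterval D u b) (geodesicInterval D v a') := by
  by_contra! h
  obtain ⟨y, hy, hy'⟩ := Set.not_disjoint_iff.1 h.1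
  obtain ⟨x, hx, hx'⟩ := Set.not_disjoint_iff.1 h.2
  obtain ⟨p, hp⟩ := hD.exists_walk_of_mem ha hb' hy hy'
  obtain ⟨q, hq⟩ := hD.exists_walk_of_mem hb ha' hx hx'
  obtain ⟨z, hzp, hzq⟩ := hm p q
  rw [Set.disjoint_left] at haa hbb
  rcases hp z hzp with h1 | h1 <;> rcases hq z hzq with h2 | h2
  · exact haa (hD.mem_of_tail hb hx h2 (hD.mem_trans hy h1)) hx'
  · exact haa (hD.mem_trans hy h1) (hD.mem_trans hx' h2)
  · exact hbb (hD.mem_trans hx h2) (hD.mem_trans hy' h1)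
  · exact haa hy (hD.mem_of_tail hb' hy' h1 (hD.mem_trans hx' h2))

/-- If the shortest paths from `u` to `c` avoid those from `v` to `a` and `b`, and `{c, e}`
crosses `{a, b}`, then they also avoid the shortest paths from `v` to `e`. -/
theorem disjoint_of_walksMeet (hD : IsGeodesicDist G D) (hc : D u c ≠ ⊤) (ha : D v a ≠ ⊤)
    (hb : D v b ≠ ⊤) (he : D v e ≠ ⊤)
    (hca : Disjoint (geodesicInterval D u c) (geodesicInterval D v a))
    (hcb : Disjoint (geodesicInterval D u c) (geodesicInterval D v b))
    (hm : WalksMeet G a b c e) :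
    Disjoint (geodesicInterval D u c) (geodesicInterval D v e) := by
  rw [Set.disjoint_left] at hca hcb ⊢
  intro x hx hx'
  obtain ⟨p, hp⟩ := hD.exists_walk v a ha
  obtain ⟨q, hq⟩ := hD.exists_walk v b hb
  obtain ⟨r, hr⟩ := hD.exists_walk_of_mem hc he hx hx'
  obtain ⟨z, hz, hzr⟩ := hm (p.reverse.append q) r
  rw [SimpleGraph.Walk.mem_support_append_iff, SimpleGraph.Walk.support_reverse,
    List.mem_reverse] at hz
  rcases hr z hzr with h | h <;> rcases hz with hz | hz
  · exact hca (hD.mem_trans hx h) (hp z hz)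
  · exact hcb (hD.mem_trans hx h) (hq z hz)
  · exact hca hx (hD.mem_of_tail he hx' h (hp z hz))
  · exact hcb hx (hD.mem_of_tail he hx' h (hq z hz))

/-- The core of the argument, for eight points in cyclic order of which `0, 3, 4, 7` are
targets of `u` and `1, 2, 5, 6` are targets of `v`. It is impossible that shortest paths from `u`
and `v` are disjoint for each of the four consecutive pairs of targets `{0, 1}`, `{2, 3}`, `{4, 5}`
and `{6, 7}`: some shortest path of `u` to `3` or `4` avoids all those of `v`, and so does one to
`7` or `0`; together they separate the targets `1` and `5` of `v`. -/
theorem false_of_disjoint (hD : IsGeodesicDist G D) (x : Fin 8 → V)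
    (hx : ∀ i j k l : Fin 8, i < j → j < k → k < l → WalksMeet G (x i) (x k) (x j) (x l))
    (hu : ∀ i, D u (x i) ≠ ⊤) (hv : ∀ i, D v (x i) ≠ ⊤)
    (h1 : Disjoint (geodesicInterval D u (x 0)) (geodesicInterval D v (x 1)))
    (h2 : Disjoint (geodesicInterval D u (x 3)) (geodesicInterval D v (x 2)))
    (h3 : Disjoint (geodesicInterval D u (x 4)) (geodesicInterval D v (x 5)))
    (h4 : Disjoint (geodesicInterval D u (x 7)) (geodesicInterval D v (x 6))) : False := by
  have key : ∀ i j : Fin 8,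
      Disjoint (geodesicInterval D u (x i)) (geodesicInterval D v (x 1)) →
      Disjoint (geodesicInterval D u (x i)) (geodesicInterval D v (x 5)) →
      Disjoint (geodesicInterval D u (x j)) (geodesicInterval D v (x 1)) →
      Disjoint (geodesicInterval D u (x j)) (geodesicInterval D v (x 5)) →
      WalksMeet G (x i) (x j) (x 1) (x 5) → False := by
    intro i j hi1 hi5 hj1 hj5 hm
    obtain ⟨p, hp⟩ := hD.exists_walk u (x i) (hu i)
    obtain ⟨q, hq⟩ := hD.exists_walk u (x j) (hu j)
    obtain ⟨r, hr⟩ := hD.exists_walk v (x 1) (hv 1)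
    obtain ⟨t, ht⟩ := hD.exists_walk v (x 5) (hv 5)
    obtain ⟨z, hz, hz'⟩ := hm (p.reverse.append q) (r.reverse.append t)
    simp only [SimpleGraph.Walk.mem_support_append_iff, SimpleGraph.Walk.support_reverse,
      List.mem_reverse] at hz hz'
    rw [Set.disjoint_left] at hi1 hi5 hj1 hj5
    rcases hz with hz | hz <;> rcases hz' with hz' | hz'
    · exact hi1 (hp z hz) (hr z hz')
    · exact hi5 (hp z hz) (ht z hz')
    · exact hj1 (hq z hz) (hr z hz')
    · exact hj5 (hq z hz) (ht z hz')
  have inner : ∃ i : Fin 8, (i = 3 ∨ i = 4) ∧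
      Disjoint (geodesicInterval D u (x i)) (geodesicInterval D v (x 1)) ∧
      Disjoint (geodesicInterval D u (x i)) (geodesicInterval D v (x 5)) := by
    rcases hD.disjoint_or_disjoint (hu 3) (hu 4) (hv 2) (hv 5) h2 h3
      (hx 2 3 4 5 (by decide) (by decide) (by decide)).symm.swap_right with h | h
    · exact ⟨3, .inl rfl, hD.disjoint_of_walksMeet (hu 3) (hv 2) (hv 5) (hv 1) h2 h
        (hx 1 2 3 5 (by decide) (by decide) (by decide)).symm.swap_right, h⟩
    · exact ⟨4, .inr rfl, hD.disjoint_of_walksMeet (hu 4) (hv 2) (hv 5) (hv 1) h h3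
        (hx 1 2 4 5 (by decide) (by decide) (by decide)).symm.swap_right, h3⟩
  have outer : ∃ j : Fin 8, (j = 0 ∨ j = 7) ∧
      Disjoint (geodesicInterval D u (x j)) (geodesicInterval D v (x 1)) ∧
      Disjoint (geodesicInterval D u (x j)) (geodesicInterval D v (x 5)) := by
    rcases hD.disjoint_or_disjoint (hu 0) (hu 7) (hv 1) (hv 6) h1 h4
      (hx 0 1 6 7 (by decide) (by decide) (by decide)).swap_right with h | h
    · exact ⟨0, .inl rfl, h1, hD.disjoint_of_walksMeet (hu 0) (hv 1) (hv 6) (hv 5) h1 h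
        (hx 0 1 5 6 (by decide) (by decide) (by decide)).symm⟩
    · exact ⟨7, .inr rfl, h, hD.disjoint_of_walksMeet (hu 7) (hv 1) (hv 6) (hv 5) h h4
        (hx 1 5 6 7 (by decide) (by decide) (by decide)).swap_right⟩
  obtain ⟨i, hi, hi1, hi5⟩ := inner
  obtain ⟨j, hj, hj1, hj5⟩ := outer
  refine key i j hi1 hi5 hj1 hj5 ?_
  rcases hj with rfl | rfl
  · exact (hx 0 1 i 5 (by decide) (by omega) (by omega)).swap
  · exact (hx 1 i 5 7 (by omega) (by omega) (by decide)).symm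

end IsGeodesicDist

end Geodesic

/-! ### The weighted distance -/

section WeightedDist

variable {V : Type*} {G : SimpleGraph V}

/-- The weighted distance as an extended non-negative real. -/
noncomputable def walkDist (G : SimpleGraph V) (w : Sym2 V → ℝ≥0) (u v : V) : ℝ≥0∞ :=
  ⨅ p : G.Walk u v, (((p.edges.map w).sum : ℝ≥0) : ℝ≥0∞)

theorem walkDist_ne_top_iff {w : Sym2 V → ℝ≥0} {u v : V} :
    walkDist G w u v ≠ ⊤ ↔ G.Reachable u v := by
  simp [walkDist, iInf_eq_top, SimpleGraph.Reachable]

/-- The weighted distance is attained: shortcutting a walk to a path does not increase its weight,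
and there are finitely many paths. -/
theorem exists_walk_sum_eq_walkDist [Finite V] (w : Sym2 V → ℝ≥0) {u v : V}
    (h : G.Reachable u v) :
    ∃ p : G.Walk u v, (((p.edges.map w).sum : ℝ≥0) : ℝ≥0∞) = walkDist G w u v := by
  classical
  have := Fintype.ofFinite V
  obtain ⟨p₀⟩ := h
  have : Nonempty (G.Path u v) := ⟨p₀.toPath⟩
  obtain ⟨p, hp⟩ := Finite.exists_min fun p : G.Path u v => (p.1.edges.map w).sum
  refine ⟨p.1, le_antisymm (le_iInf fun q => ?_) (iInf_le _ p.1)⟩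
  refine ENNReal.coe_le_coe.2 ((hp q.toPath).trans ?_)
  exact (q.edges_bypass_sublist_edges.map w).sum_le_sum fun _ _ => zero_le

theorem isGeodesicDist_walkDist [Finite V] (G : SimpleGraph V) (w : Sym2 V → ℝ≥0) :
    IsGeodesicDist G (walkDist G w) := by
  classical
  have tri : ∀ x y z, walkDist G w x z ≤ walkDist G w x y + walkDist G w y z := by
    intro x y z
    by_cases hxy : G.Reachable x y
    · by_cases hyz : G.Reachable y z
      · obtain ⟨p, hp⟩ := exists_walk_sum_eq_walkDist w hxy
        obtain ⟨q, hq⟩ := exists_walk_sum_eq_walkDist w hyz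
        refine (iInf_le _ (p.append q)).trans ?_
        rw [← hp, ← hq, SimpleGraph.Walk.edges_append, List.map_append, List.sum_append,
          ENNReal.coe_add]
      · rw [← walkDist_ne_top_iff (w := w), not_not] at hyz
        simp [hyz]
    · rw [← walkDist_ne_top_iff (w := w), not_not] at hxy
      simp [hxy]
  refine ⟨tri, fun x y hxy => ?_⟩
  obtain ⟨p, hp⟩ := exists_walk_sum_eq_walkDist w (walkDist_ne_top_iff.1 hxy)
  refine ⟨p, fun z hz => le_antisymm ?_ (tri _ _ _)⟩
  rw [← hp]
  conv_rhs => rw [← p.take_spec hz]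
  rw [SimpleGraph.Walk.edges_append, List.map_append, List.sum_append, ENNReal.coe_add]
  exact add_le_add (iInf_le _ _) (iInf_le _ _)

theorem hopDist_eq_weightedDist (G : SimpleGraph V) : hopDist G = weightedDist G 1 := by
  ext u v
  have h : ∀ p : G.Walk u v, (((p.edges.map (1 : Sym2 V → ℝ≥0)).sum : ℝ≥0) : ℝ≥0∞) =
      ((p.length : ℕ∞) : ℝ≥0∞) := fun p => by
    have : (1 : Sym2 V → ℝ≥0) = fun _ => 1 := rfl
    rw [this, List.map_const', List.sum_replicate]
    simp
  simp only [hopDist, weightedDist, h]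
  congr 1
  refine le_antisymm (le_iInf fun p => ENat.toENNReal_le.2 (SimpleGraph.edist_le p)) ?_
  by_cases hr : G.Reachable u v
  · obtain ⟨p, hp⟩ := hr.exists_walk_length_eq_edist
    rw [← hp]
    exact iInf_le _ p
  · simp [SimpleGraph.edist_eq_top_of_not_reachable hr]

end WeightedDist

/-! ### Shattered sets -/

section Shattering

variable {V : Type*}

theorem nearSet_mono (d : V → V → EReal) {ℓ : ℕ} (s : Fin ℓ → V) (i : Fin ℓ)
    (hi : (i : ℕ) + 1 < ℓ) {Δ Δ' : ℝ} (h : Δ ≤ Δ') : nearSet d s i hi Δ ⊆ nearSet d s i hi Δ' :=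
  fun _ hv => le_trans hv (add_le_add_right (EReal.coe_le_coe_iff.2 h) _)

theorem ShattersSet.exists_mem_comparisonSet_iff {d : V → V → EReal} {ℓ : ℕ} {s : Fin ℓ → V}
    {M : Set ℝ} {Y : Set (Fin ℓ × ℝ)} (h : ShattersSet (comparisonFamily d s M) Y)
    (P : Fin ℓ × ℝ → Prop) : ∃ v, ∀ y ∈ Y, y ∈ comparisonSet d s M v ↔ P y := by
  obtain ⟨_, ⟨v, rfl⟩, hv⟩ := h {y ∈ Y | P y} (Set.sep_subset _ _)
  refine ⟨v, fun y hy => ?_⟩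
  have := Set.ext_iff.1 hv y
  simpa [hy] using this

/-- If four pairs are shattered, then their indices are distinct, as the sets belonging to one
index are nested. With the indices in increasing order, there are two vertices with alternating
comparisons. -/
theorem setVCDim_comparisonFamily_le_three {d : V → V → EReal} {ℓ : ℕ} {s : Fin ℓ → V}
    (h : ∀ (i : Fin 4 → Fin ℓ) (hi : ∀ j, (i j : ℕ) + 1 < ℓ) (Δ : Fin 4 → ℝ) (u v : V),
      StrictMono i → (∀ j, u ∈ nearSet d s (i j) (hi j) (Δ j) ↔ j = 0 ∨ j = 2) →
      (∀ j, v ∈ nearSet d s (i j) (hi j) (Δ j) ↔ j = 1 ∨ j = 3) → False) (M : Set ℝ) :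
    setVCDim (thresholdUniverse ℓ M) (comparisonFamily d s M) ≤ 3 := by
  refine iSup₂_le fun Y ⟨hYX, hY⟩ => ?_
  by_contra! hcard
  have hmem : ∀ y ∈ Y, ∃ hi : (y.1 : ℕ) + 1 < ℓ, ∀ v,
      y ∈ comparisonSet d s M v ↔ v ∈ nearSet d s y.1 hi y.2 := by
    intro y hy
    obtain ⟨v, hv⟩ := hY.exists_mem_comparisonSet_iff fun _ => True
    obtain ⟨hM, hi, -⟩ := (hv y hy).2 trivial
    exact ⟨hi, fun v => ⟨fun h => h.2.2, fun h => ⟨hM, hi, h⟩⟩⟩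
  have hle : ∀ y ∈ Y, ∀ y' ∈ Y, y.1 = y'.1 → y'.2 ≤ y.2 := by
    rintro ⟨i, Δ⟩ hy ⟨j, Δ'⟩ hy' (rfl : i = j)
    by_contra! hlt
    obtain ⟨v, hv⟩ := hY.exists_mem_comparisonSet_iff fun y => y = (i, Δ)
    obtain ⟨hi, h1⟩ := hmem _ hy
    obtain ⟨_, h2⟩ := hmem _ hy'
    have h3 := (hv _ hy').1 ((h2 v).2 (nearSet_mono d s i hi hlt.le ((h1 v).1 ((hv _ hy).2 rfl))))
    exact hlt.ne' (Prod.ext_iff.1 h3).2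
  have hinj : Set.InjOn Prod.fst Y := fun y hy y' hy' e =>
    Prod.ext e (le_antisymm (hle _ hy' _ hy e.symm) (hle _ hy _ hy' e))
  rw [← hinj.encard_image] at hcard
  obtain ⟨T, hTY, hT⟩ := Set.exists_subset_encard_eq (s := Prod.fst '' Y) (k := 4)
    (Order.add_one_le_of_lt hcard)
  have hTcard : T.toFinite.toFinset.card = 4 := by
    rw [T.toFinite.encard_eq_coe_toFinset_card] at hT
    exact_mod_cast hT
  let i := T.toFinite.toFinset.orderEmbOfFin hTcard
  have hiT : ∀ j, ∃ Δ : ℝ, (i j, Δ) ∈ Y := fun j => by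
    have h1 : i j ∈ T :=
      T.toFinite.mem_toFinset.1 (T.toFinite.toFinset.orderEmbOfFin_mem hTcard j)
    obtain ⟨⟨a, Δ⟩, hy, e⟩ := hTY h1
    exact ⟨Δ, by rwa [← e]⟩
  choose Δ hΔ using hiT
  choose hi hnear using fun j => hmem _ (hΔ j)
  obtain ⟨u, hu⟩ := hY.exists_mem_comparisonSet_iff fun y => y.1 = i 0 ∨ y.1 = i 2
  obtain ⟨v, hv⟩ := hY.exists_mem_comparisonSet_iff fun y => y.1 = i 1 ∨ y.1 = i 3
  refine h i hi Δ u v i.strictMono (fun j => ?_) fun j => ?_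
  · rw [← hnear, hu _ (hΔ j), i.injective.eq_iff, i.injective.eq_iff]
  · rw [← hnear, hv _ (hΔ j), i.injective.eq_iff, i.injective.eq_iff]

/-- If a comparison holds at `u` and fails at `v`, then the shortest paths from `u` to the first
site are disjoint from those from `v` to the second site. -/
theorem disjoint_of_mem_nearSet {G : SimpleGraph V} {D : V → V → ℝ≥0∞} (hD : IsGeodesicDist G D)
    {ℓ : ℕ} {s : Fin ℓ → V} {i : Fin ℓ} {hi : (i : ℕ) + 1 < ℓ} {Δ : ℝ} {u v : V}
    (hu : D u (s ⟨i + 1, hi⟩) ≠ ⊤) (hv : D v (s ⟨i + 1, hi⟩) ≠ ⊤)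
    (hu' : D u (s i) ≠ ⊤) (hv' : D v (s i) ≠ ⊤)
    (hmem : u ∈ nearSet (fun x y => (D x y : EReal)) s i hi Δ)
    (hnot : v ∉ nearSet (fun x y => (D x y : EReal)) s i hi Δ) :
    Disjoint (geodesicInterval D u (s i)) (geodesicInterval D v (s ⟨i + 1, hi⟩)) := by
  rw [Set.disjoint_left]
  intro z hz hz'
  have h := hD.swap_le hz hz'
  simp only [nearSet, Set.mem_ofPred_eq, not_le] at hmem hnot
  lift D u (s ⟨i + 1, hi⟩) to ℝ≥0 using hu with a
  lift D v (s ⟨i + 1, hi⟩) to ℝ≥0 using hv with b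
  lift D u (s i) to ℝ≥0 using hu' with a'
  lift D v (s i) to ℝ≥0 using hv' with b'
  simp only [EReal.coe_nnreal_eq_coe_real] at hmem hnot
  have h1 : (a' : ℝ) ≤ a + Δ := by exact_mod_cast hmem
  have h2 : (b : ℝ) + Δ < b' := by exact_mod_cast hnot
  have h3 : (a : ℝ) + b' ≤ a' + b := by exact_mod_cast h
  linarith

end Shattering

namespace RotationSystem

variable {V : Type*} {G : SimpleGraph V} {R : RotationSystem G}

theorem fst_reachable_iterate (R : RotationSystem G) (a : G.Dart) (t : ℕ) :
    G.Reachable a.fst (R.facePerm^[t] a).fst := by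
  induction t with
  | zero => rfl
  | succ t ih =>
    rw [Function.iterate_succ_apply', fst_facePerm]
    exact ih.trans (R.facePerm^[t] a).adj.reachable

theorem InFacialOrder.reachable {ℓ : ℕ} {s : Fin ℓ → V} (hs : R.InFacialOrder s) (i j : Fin ℓ) :
    G.Reachable (s i) (s j) := by
  rcases hs with hℓ | ⟨a, k, -, -, hs⟩
  · have := Fin.subsingleton_iff_le_one.2 hℓ
    rw [Subsingleton.elim i j]
  · rw [hs i, hs j]
    exact (R.fst_reachable_iterate a _).symm.trans (R.fst_reachable_iterate a _)

theorem InFacialOrder.walksMeet [Finite V] (hR : R.IsPlanar) {ℓ : ℕ} {s : Fin ℓ → V}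
    (hs : R.InFacialOrder s) {i j k l : Fin ℓ} (hij : i ≤ j) (hjk : j ≤ k) (hkl : k ≤ l) :
    WalksMeet G (s i) (s k) (s j) (s l) := by
  intro p q
  rcases hij.eq_or_lt with rfl | hij
  · exact ⟨_, p.start_mem_support, q.start_mem_support⟩
  rcases hjk.eq_or_lt with rfl | hjk
  · exact ⟨_, p.end_mem_support, q.start_mem_support⟩
  rcases hkl.eq_or_lt with rfl | hkl
  · exact ⟨_, p.end_mem_support, q.end_mem_support⟩
  rcases hs with hℓ | ⟨a, t, ht, htp, hs⟩
  · have := Fin.subsingleton_iff_le_one.2 hℓ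
    exact (hij.ne (Subsingleton.elim _ _)).elim
  · obtain rfl : s = fun j => (R.facePerm^[t j] a).fst := funext hs
    exact hR.exists_mem_support (ht hij) (ht hjk) (ht hkl) (htp l) p q

theorem IsPlanar.setVCDim_weightedDist_le [Finite V] (hR : R.IsPlanar) {ℓ : ℕ} {s : Fin ℓ → V}
    (hs : R.InFacialOrder s ∨ R.InFacialOrder (s ∘ Fin.rev)) (w : Sym2 V → ℝ≥0) (M : Set ℝ) :
    setVCDim (thresholdUniverse ℓ M) (comparisonFamily (weightedDist G w) s M) ≤ 3 := by
  have hreach : ∀ i j, G.Reachable (s i) (s j) := fun i j => by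
    rcases hs with hs | hs
    · exact hs.reachable i j
    · simpa using hs.reachable i.rev j.rev
  have hmeet : ∀ {i j k l : Fin ℓ}, i ≤ j → j ≤ k → k ≤ l →
      WalksMeet G (s i) (s k) (s j) (s l) := by
    intro i j k l hij hjk hkl
    rcases hs with hs | hs
    · exact hs.walksMeet hR hij hjk hkl
    · have := hs.walksMeet hR (Fin.rev_le_rev.2 hkl) (Fin.rev_le_rev.2 hjk) (Fin.rev_le_rev.2 hij)
      simp only [Function.comp_apply, Fin.rev_rev] at this
      exact this.symm.swap.swap_right
  refine setVCDim_comparisonFamily_le_three (fun i hi Δ u v hmono hu hv => ?_) M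
  have hD := isGeodesicDist_walkDist G w
  -- A vertex in another component than the face would belong to all of the sets.
  have hfin : ∀ x j, x ∉ nearSet (weightedDist G w) s (i j) (hi j) (Δ j) →
      ∀ k, walkDist G w x (s k) ≠ ⊤ := by
    intro x j hx k
    have h1 : walkDist G w x (s ⟨i j + 1, hi j⟩) ≠ ⊤ := by
      intro h
      refine hx ?_
      change _ ≤ (walkDist G w x (s ⟨i j + 1, hi j⟩) : EReal) + _
      rw [h, EReal.coe_ennreal_top, EReal.top_add_coe]
      exact le_top
    exact walkDist_ne_top_iff.2 ((walkDist_ne_top_iff.1 h1).trans (hreach _ _))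
  have hu' := hfin u 1 (by simp [hu])
  have hv' := hfin v 0 (by simp [hv])
  let n : Fin 4 → Fin ℓ := fun j => ⟨i j + 1, hi j⟩
  have hin : ∀ j, i j ≤ n j := fun j => Nat.le_succ _
  have hni : ∀ j k, j < k → n j ≤ i k := fun j k h => Nat.succ_le_of_lt (hmono h)
  let x : Fin 8 → Fin ℓ := ![i 0, n 0, i 1, n 1, i 2, n 2, i 3, n 3]
  have hx : Monotone x := by
    rw [Fin.monotone_iff_le_succ]
    intro j
    fin_cases j
    · exact hin 0
    · exact hni 0 1 (by decide)
    · exact hin 1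
    · exact hni 1 2 (by decide)
    · exact hin 2
    · exact hni 2 3 (by decide)
    · exact hin 3
  have hdisj : ∀ j (y z : V), (∀ k, walkDist G w y (s k) ≠ ⊤) → (∀ k, walkDist G w z (s k) ≠ ⊤) →
      y ∈ nearSet (weightedDist G w) s (i j) (hi j) (Δ j) →
      z ∉ nearSet (weightedDist G w) s (i j) (hi j) (Δ j) →
      Disjoint (geodesicInterval (walkDist G w) y (s (i j)))
        (geodesicInterval (walkDist G w) z (s (n j))) := fun j y z hy hz hmem hnot =>
    disjoint_of_mem_nearSet hD (hy _) (hz _) (hy _) (hz _) hmem hnot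
  exact hD.false_of_disjoint (u := u) (v := v) (s ∘ x)
    (fun a b c e hab hbc hce => hmeet (hx hab.le) (hx hbc.le) (hx hce.le))
    (fun _ => hu' _) (fun _ => hv' _)
    (hdisj 0 u v hu' hv' (by simp [hu]) (by simp [hv]))
    (hdisj 1 v u hv' hu' (by simp [hv]) (by simp [hu])).symm
    (hdisj 2 u v hu' hv' (by simp [hu]) (by simp [hv]))
    (hdisj 3 v u hv' hu' (by simp [hv]) (by simp [hu])).symm

end RotationSystem

theorem mainTheorem2 {V : Type*} [Finite V] (G : SimpleGraph V) (R : RotationSystem G)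
    (hR : R.IsPlanar) (ℓ : ℕ) (s : Fin ℓ → V)
    (hs : R.InFacialOrder s ∨ R.InFacialOrder (s ∘ Fin.rev)) :
    (∀ M : Set ℝ,
      setVCDim (thresholdUniverse ℓ M) (comparisonFamily (hopDist G) s M) ≤ 3) ∧
    (∀ (w : Sym2 V → ℝ≥0) (M : Set ℝ),
      setVCDim (thresholdUniverse ℓ M) (comparisonFamily (weightedDist G w) s M) ≤ 3) := by
  refine ⟨fun M => ?_, fun w M => hR.setVCDim_weightedDist_le hs w M⟩
  rw [hopDist_eq_weightedDist]
  exact hR.setVCDim_weightedDist_le hs 1 M
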